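/- Let $M$ be a (finite-dimensional, Hausdorff) smooth manifold, let $n\ge 0$ be an integer, and let $\Omega$ be an arbitrary smooth $(n+2)$-form on $M$. Notation. For an $r$-vector $X$ and a form $\alpha$ of degree $\ge r$, the interior product is $(\mathbf i_X\alpha)(Z)=\alpha(X\wedge Z)$. For $1\le r\le n+1$ let $P_r=\Lambda^r TM\oplus\Lambda^{n+2-r}T^*M$. For $(X,\Sigma)\in P_r$, $(\bar X,\bar\Sigma)\in P_s$ put $$\langle\!\langle (X,\Sigma),(\bar X,\bar\Sigma)\rangle\!\rangle_-=\tfrac12\big(\mathbf i_{\bar X}\Sigma-(-1)^{rs}\mathbf i_X\bar\Sigma\big).$$ An almost multi-Dirac structure of degree $n+1$ on $M$ is a sequence of smooth subbundles $D_r\subset P_r$ $(1\le r\le n+1)$ such that, for all $r,s\ge 1$ with $r+s\le n+2$, $D_r$ is the orthogonal complement of $D_s$ in $P_r$ with respect to $\langle\!\langle\cdot,\cdot\rangle\!\rangle_-$. The graph of $\Omega$ is the almost multi-Dirac structure $$D_r=\{(X,\Sigma)\in P_r : \mathbf i_X\Omega=\Sigma\},\qquad r=1,\dots,n+1.$$ For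 an $r$-multivector field $X$ and a form $\Sigma$ let $\pounds_X\Sigma=\mathbf i_X\mathbf d\Sigma-(-1)^r\mathbf d\,\mathbf i_X\Sigma$. The Schouten–Nijenhuis bracket of multivector fields is the local $\mathbb R$-bilinear bracket given on decomposable fields by $$[X_1\wedge\cdots\wedge X_r,\;Y_1\wedge\cdots\wedge Y_s]=\sum_{i,j}(-1)^{i+j}[X_i,Y_j]\wedge Y_1\wedge\cdots\widehat{Y_j}\cdots\wedge Y_s\wedge X_1\wedge\cdots\widehat{X_i}\cdots\wedge X_r .$$ For sections $(X,\Sigma)$ of $P_r$ and $(\bar X,\bar\Sigma)$ of $P_s$ with $r+s\le n+2$, the multi-Courant bracket is the pair $$[\![(X,\Sigma),(\bar X,\bar\Sigma)]\!]_{r,s}=\Big([X,\bar X],\ \pounds_X\bar\Sigma-(-1)^{(r-1)(s-1)}\pounds_{\bar X}\Sigma+\tfrac{(-1)^r}{2}\,\mathbf d\big(\mathbf i_X\bar\Sigma+(-1)^{rs}\mathbf i_{\bar X}\Sigma\big)\Big),$$ a section of $P_{r+s-1}$. For an integer $N$, say that $D$ is integrable up to $N$ if for all $r,s\ge1$ with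 $r+s\le\min(N,n+2)$ and all smooth sections $(X,\Sigma)$ of $D_r$ and $(\bar X,\bar\Sigma)$ of $D_s$, the bracket $[\![(X,\Sigma),(\bar X,\bar\Sigma)]\!]_{r,s}$ is a section of $D_{r+s-1}$. Theorem. Let $D$ be the graph of $\Omega$. Then $D$ is integrable up to $n+2$ (that is, closed under all multi-Courant brackets that are defined) if and only if $\mathbf d\Omega=0$. If moreover $n\ge1$, then already integrability up to $n+1$ is equivalent to $\mathbf d\Omega=0$. -/

import Mathlib

open scoped Manifold ContDiff Topology
noncomputable section
namespace MultiDirac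

section Algebra
variable {V W : Type*} [AddCommGroup V] [Module ℝ V] [AddCommGroup W] [Module ℝ W]

/-- A `k`-covector `α` as a linear functional on multivectors: `α(v₁ ∧ ⋯ ∧ v_k) = α(v₁, …, v_k)`,
and `α` vanishes on multivectors of degree different from `k`. -/
def pairing {k : ℕ} (α : V [⋀^Fin k]→ₗ[ℝ] ℝ) : ExteriorAlgebra ℝ V →ₗ[ℝ] ℝ :=
  ExteriorAlgebra.liftAlternating (Pi.single k α)

theorem pairing_ιMulti {k : ℕ} (α : V [⋀^Fin k]→ₗ[ℝ] ℝ) (v : Fin k → V) :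
    pairing α (ExteriorAlgebra.ιMulti ℝ k v) = α v := by
  simp [pairing]

theorem pairing_ιMulti_of_ne {k l : ℕ} (h : l ≠ k) (α : V [⋀^Fin k]→ₗ[ℝ] ℝ) (v : Fin l → V) :
    pairing α (ExteriorAlgebra.ιMulti ℝ l v) = 0 := by
  simp [pairing, Pi.single_eq_of_ne h]

theorem pairing_add {k : ℕ} (α β : V [⋀^Fin k]→ₗ[ℝ] ℝ) : pairing (α + β) = pairing α + pairing β := by
  simp [pairing, Pi.single_add]

theorem pairing_smul {k : ℕ} (c : ℝ) (α : V [⋀^Fin k]→ₗ[ℝ] ℝ) : pairing (c • α) = c • pairing α := by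
  simp [pairing, Pi.single_smul]

theorem pairing_compLinearMap {k : ℕ} (f : W →ₗ[ℝ] V) (α : V [⋀^Fin k]→ₗ[ℝ] ℝ)
    (X : ExteriorAlgebra ℝ W) :
    pairing (α.compLinearMap f) X = pairing α (ExteriorAlgebra.map f X) := by
  have : pairing (α.compLinearMap f) = (pairing α) ∘ₗ (ExteriorAlgebra.map f).toLinearMap := by
    apply ExteriorAlgebra.lhom_ext
    intro i
    ext v
    by_cases h : i = k
    · subst h
      simp [pairing_ιMulti, Function.comp_def]
    · simp [pairing_ιMulti_of_ne h]
  simp [this]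

@[elab_as_elim]
theorem decomposable_induction {r : ℕ} {p : ⋀[ℝ]^r V → Prop}
    (h0 : ∀ v, p (exteriorPower.ιMulti ℝ r v))
    (h1 : ∀ X Y, p X → p Y → p (X + Y)) (h2 : ∀ (c : ℝ) X, p X → p (c • X)) (X : ⋀[ℝ]^r V) :
    p X := by
  have hX : X ∈ Submodule.span ℝ (Set.range (exteriorPower.ιMulti ℝ r (M := V))) := by
    rw [exteriorPower.ιMulti_span]; trivial
  induction hX using Submodule.span_induction with
  | mem x hx => obtain ⟨v, rfl⟩ := hx; exact h0 v
  | zero => simpa using h2 0 _ (h0 0)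
  | add x y _ _ hx hy => exact h1 _ _ hx hy
  | smul a x _ hx => exact h2 _ _ hx

theorem pairing_mul_ιMulti_of_ne {r k i : ℕ} (h : r + i ≠ k) (X : ⋀[ℝ]^r V)
    (α : V [⋀^Fin k]→ₗ[ℝ] ℝ) (v : Fin i → V) :
    pairing α ((X : ExteriorAlgebra ℝ V) * ExteriorAlgebra.ιMulti ℝ i v) = 0 := by
  refine decomposable_induction (fun w => ?_) (fun a b ha hb => ?_) (fun c a ha => ?_) X
  · rw [exteriorPower.ιMulti_apply_coe, ExteriorAlgebra.ιMulti_mul_ιMulti, pairing_ιMulti_of_ne h]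
  · rw [Submodule.coe_add, add_mul, map_add, ha, hb, add_zero]
  · rw [Submodule.coe_smul, smul_mul_assoc, map_smul, ha, smul_zero]

/-- Graded commutativity of the wedge product. -/
theorem wedge_comm {r s : ℕ} (X : ⋀[ℝ]^r V) (Y : ⋀[ℝ]^s V) :
    (X : ExteriorAlgebra ℝ V) * Y = (-1 : ℝ) ^ (r * s) • ((Y : ExteriorAlgebra ℝ V) * X) := by
  have h1 : ∀ (s : ℕ) (w : Fin s → V) (a : V), ExteriorAlgebra.ι ℝ a * ExteriorAlgebra.ιMulti ℝ s w
      = (-1 : ℝ) ^ s • (ExteriorAlgebra.ιMulti ℝ s w * ExteriorAlgebra.ι ℝ a) := by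
    intro s
    induction s with
    | zero => intro w a; simp
    | succ s ih =>
      intro w a
      have e : ExteriorAlgebra.ι ℝ a * ExteriorAlgebra.ι ℝ (w 0)
          = - (ExteriorAlgebra.ι ℝ (w 0) * ExteriorAlgebra.ι ℝ a) :=
        eq_neg_of_add_eq_zero_left (ExteriorAlgebra.ι_add_mul_swap _ _)
      rw [ExteriorAlgebra.ιMulti_succ_apply, ← mul_assoc, e, neg_mul, mul_assoc, ih, mul_assoc]
      simp [pow_succ]
  have h2 : ∀ (r : ℕ) (v : Fin r → V) (w : Fin s → V),
      ExteriorAlgebra.ιMulti ℝ r v * ExteriorAlgebra.ιMulti ℝ s w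
      = (-1 : ℝ) ^ (r * s) • (ExteriorAlgebra.ιMulti ℝ s w * ExteriorAlgebra.ιMulti ℝ r v) := by
    intro r
    induction r with
    | zero => intro v w; simp
    | succ r ih =>
      intro v w
      rw [ExteriorAlgebra.ιMulti_succ_apply, mul_assoc, ih, mul_smul_comm, ← mul_assoc, h1,
        smul_mul_assoc, smul_smul, mul_assoc]
      congr 1
      ring
  refine decomposable_induction (fun v => ?_) (fun a b ha hb => ?_) (fun c a ha => ?_) X
  · refine decomposable_induction (fun w => ?_) (fun a b ha hb => ?_) (fun c a ha => ?_) Y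
    · exact h2 r v w
    · simp only [Submodule.coe_add, mul_add, add_mul, ha, hb, smul_add]
    · simp only [Submodule.coe_smul, mul_smul_comm, smul_mul_assoc, ha]
      rw [smul_comm]
  · simp only [Submodule.coe_add, mul_add, add_mul, ha, hb, smul_add]
  · simp only [Submodule.coe_smul, mul_smul_comm, smul_mul_assoc, ha]
    rw [smul_comm]

/-- The contraction `ξ ⌟ X` of a multivector with a covector,
`ξ ⌟ (v₁ ∧ ⋯ ∧ v_r) = ∑ i, (-1)^(i-1) ξ(v_i) v₁ ∧ ⋯ v̂_i ⋯ ∧ v_r`. -/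
def contract (ξ : Module.Dual ℝ V) : ExteriorAlgebra ℝ V →ₗ[ℝ] ExteriorAlgebra ℝ V :=
  CliffordAlgebra.contractLeft ξ

theorem contract_mem (ξ : Module.Dual ℝ V) {r : ℕ} (X : ⋀[ℝ]^(r + 1) V) :
    contract ξ X ∈ ⋀[ℝ]^r V := by
  refine decomposable_induction (fun v => ?_) (fun a b ha hb => ?_) (fun c a ha => ?_) X
  · induction r with
    | zero =>
      have : contract ξ (ExteriorAlgebra.ι ℝ (v 0)) = algebraMap ℝ _ (ξ (v 0)) :=
        CliffordAlgebra.contractLeft_ι _ _ _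
      simp [this]
    | succ r ih =>
      have : ∀ a b, contract ξ (ExteriorAlgebra.ι ℝ a * b)
          = ξ a • b - ExteriorAlgebra.ι ℝ a * contract ξ b :=
        fun a b => CliffordAlgebra.contractLeft_ι_mul _ _ _
      rw [exteriorPower.ιMulti_apply_coe, ExteriorAlgebra.ιMulti_succ_apply, this]
      refine Submodule.sub_mem _ (Submodule.smul_mem _ _ ?_) ?_
      · exact ExteriorAlgebra.ιMulti_range ℝ (r + 1) ⟨_, rfl⟩
      · change _ ∈ (LinearMap.range (ExteriorAlgebra.ι ℝ)) ^ (r + 1)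
        rw [pow_succ']
        exact Submodule.mul_mem_mul ⟨_, rfl⟩ (ih 0 (Matrix.vecTail v))
  · simpa using Submodule.add_mem _ ha hb
  · simpa using Submodule.smul_mem _ c ha

theorem wedge_contract_mem (ξ : Module.Dual ℝ V) {r s : ℕ} (hr : 1 ≤ r) (X : ⋀[ℝ]^r V)
    (Y : ⋀[ℝ]^s V) :
    (Y : ExteriorAlgebra ℝ V) * contract ξ X ∈ ⋀[ℝ]^(r + s - 1) V := by
  obtain ⟨r, rfl⟩ : ∃ t, r = t + 1 := ⟨r - 1, by omega⟩
  have : r + 1 + s - 1 = s + r := by omega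
  rw [this]
  change _ ∈ (LinearMap.range (ExteriorAlgebra.ι ℝ)) ^ (s + r)
  rw [pow_add]
  exact Submodule.mul_mem_mul Y.2 (contract_mem ξ X)

end Algebra

section Interior
variable {V W : Type*} [AddCommGroup V] [Module ℝ V] [TopologicalSpace V]
  [AddCommGroup W] [Module ℝ W] [TopologicalSpace W]

theorem continuous_pairing_mul {r k q : ℕ} (X : ⋀[ℝ]^r V) (α : V [⋀^Fin k]→L[ℝ] ℝ) :
    Continuous fun v : Fin q → V =>
      pairing α.toAlternatingMap (X * ExteriorAlgebra.ιMulti ℝ q v) := by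
  refine decomposable_induction (fun w => ?_) (fun a b ha hb => ?_) (fun c a ha => ?_) X
  · simp only [exteriorPower.ιMulti_apply_coe, ExteriorAlgebra.ιMulti_mul_ιMulti]
    by_cases h : r + q = k
    · subst h
      simp only [pairing_ιMulti]
      refine α.cont.comp (continuous_pi fun i => ?_)
      refine Fin.addCases (fun j => ?_) (fun j => ?_) i
      · simpa using continuous_const
      · simpa using continuous_apply j
    · simpa only [pairing_ιMulti_of_ne h] using continuous_const
  · simp only [Submodule.coe_add, add_mul, map_add]
    exact ha.add hb
  · simp only [Submodule.coe_smul, smul_mul_assoc, map_smul]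
    exact ha.const_smul c

/-- The interior product `i_X α` of an `r`-vector `X` and a `k`-covector `α`, as a `q`-covector,
where `k = r + q`: it is given by `(i_X α)(Z) = α(X ∧ Z)`
for all `q`-vectors `Z`. (If `k ≠ r + q`, this is zero.) -/
def interior {r k q : ℕ} (X : ⋀[ℝ]^r V) (α : V [⋀^Fin k]→L[ℝ] ℝ) : V [⋀^Fin q]→L[ℝ] ℝ where
  toAlternatingMap := ((pairing α.toAlternatingMap) ∘ₗ
    (LinearMap.mulLeft ℝ (X : ExteriorAlgebra ℝ V))).compAlternatingMap (ExteriorAlgebra.ιMulti ℝ q)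
  cont := continuous_pairing_mul X α

theorem interior_apply {r k q : ℕ} (X : ⋀[ℝ]^r V) (α : V [⋀^Fin k]→L[ℝ] ℝ) (v : Fin q → V) :
    interior X α v = pairing α.toAlternatingMap (X * ExteriorAlgebra.ιMulti ℝ q v) := rfl

theorem interior_add {r k q : ℕ} (X Y : ⋀[ℝ]^r V) (α : V [⋀^Fin k]→L[ℝ] ℝ) :
    (interior (X + Y) α : V [⋀^Fin q]→L[ℝ] ℝ) = interior X α + interior Y α := by
  ext v; simp [interior_apply, add_mul]

theorem interior_smul {r k q : ℕ} (c : ℝ) (X : ⋀[ℝ]^r V) (α : V [⋀^Fin k]→L[ℝ] ℝ) :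
    (interior (c • X) α : V [⋀^Fin q]→L[ℝ] ℝ) = c • interior X α := by
  ext v; simp [interior_apply]

theorem interior_add_right {r k q : ℕ} (X : ⋀[ℝ]^r V) (α β : V [⋀^Fin k]→L[ℝ] ℝ) :
    (interior X (α + β) : V [⋀^Fin q]→L[ℝ] ℝ) = interior X α + interior X β := by
  ext v
  have := congrArg (fun f => f (X * ExteriorAlgebra.ιMulti ℝ q v))
    (pairing_add α.toAlternatingMap β.toAlternatingMap)
  simpa [interior_apply] using this

theorem interior_smul_right {r k q : ℕ} (X : ⋀[ℝ]^r V) (c : ℝ) (α : V [⋀^Fin k]→L[ℝ] ℝ) :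
    (interior X (c • α) : V [⋀^Fin q]→L[ℝ] ℝ) = c • interior X α := by
  ext v
  have := congrArg (fun f => f (X * ExteriorAlgebra.ιMulti ℝ q v))
    (pairing_smul c α.toAlternatingMap)
  simpa [interior_apply] using this

theorem pairing_interior {r q k : ℕ} (X : ⋀[ℝ]^r V) (α : V [⋀^Fin k]→L[ℝ] ℝ) (h : r + q = k)
    (Z : ExteriorAlgebra ℝ V) :
    pairing (interior X α : V [⋀^Fin q]→L[ℝ] ℝ).toAlternatingMap Z
      = pairing α.toAlternatingMap (X * Z) := by
  have : pairing (interior X α : V [⋀^Fin q]→L[ℝ] ℝ).toAlternatingMap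
      = pairing α.toAlternatingMap ∘ₗ LinearMap.mulLeft ℝ (X : ExteriorAlgebra ℝ V) := by
    apply ExteriorAlgebra.lhom_ext
    intro i
    ext v
    change pairing _ (ExteriorAlgebra.ιMulti ℝ i v)
      = pairing _ ((X : ExteriorAlgebra ℝ V) * ExteriorAlgebra.ιMulti ℝ i v)
    by_cases hi : i = q
    · subst hi
      rw [pairing_ιMulti]
      rfl
    · rw [pairing_ιMulti_of_ne hi, pairing_mul_ιMulti_of_ne (by omega)]
  rw [this]
  rfl

/-- `i_Y i_X α = (-1)^(rs) i_X i_Y α`. -/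
theorem interior_interior {r s q a b k : ℕ} (X : ⋀[ℝ]^r V) (Y : ⋀[ℝ]^s V)
    (α : V [⋀^Fin k]→L[ℝ] ℝ) (ha : r + a = k) (hb : s + b = k) :
    (interior Y (interior X α : V [⋀^Fin a]→L[ℝ] ℝ) : V [⋀^Fin q]→L[ℝ] ℝ)
      = (-1 : ℝ) ^ (r * s) • interior X (interior Y α : V [⋀^Fin b]→L[ℝ] ℝ) := by
  ext v
  rw [interior_apply, pairing_interior X α ha, ContinuousAlternatingMap.smul_apply,
    interior_apply, pairing_interior Y α hb, ← mul_assoc, ← mul_assoc, wedge_comm X Y,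
    smul_mul_assoc, map_smul]

/-- A covector whose contractions with all `s`-vectors vanish is zero. -/
theorem eq_zero_of_interior_eq_zero {s q k : ℕ} (h : s + q = k) (β : V [⋀^Fin k]→L[ℝ] ℝ)
    (hβ : ∀ Y : ⋀[ℝ]^s V, (interior Y β : V [⋀^Fin q]→L[ℝ] ℝ) = 0) : β = 0 := by
  subst h
  ext v
  have := congrArg (fun f => f fun j => v (Fin.natAdd s j))
    (hβ (exteriorPower.ιMulti ℝ s fun i => v (Fin.castAdd q i)))
  simp only [interior_apply, exteriorPower.ιMulti_apply_coe, ExteriorAlgebra.ιMulti_mul_ιMulti,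
    pairing_ιMulti] at this
  rwa [Fin.append_castAdd_natAdd] at this

theorem interior_compContinuousLinearMap {r k q : ℕ} (f : W →L[ℝ] V) (X : ⋀[ℝ]^r W)
    (α : V [⋀^Fin k]→L[ℝ] ℝ) :
    (interior X (α.compContinuousLinearMap f) : W [⋀^Fin q]→L[ℝ] ℝ)
      = (interior (exteriorPower.map r f.toLinearMap X) α).compContinuousLinearMap f := by
  ext v
  have h1 : (α.compContinuousLinearMap f).toAlternatingMap
      = α.toAlternatingMap.compLinearMap f.toLinearMap := rfl
  have h2 : ((exteriorPower.map r f.toLinearMap X : ⋀[ℝ]^r V) : ExteriorAlgebra ℝ V)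
      = ExteriorAlgebra.map f.toLinearMap X := by
    refine decomposable_induction (p := fun X => ((exteriorPower.map r f.toLinearMap X : ⋀[ℝ]^r V) :
      ExteriorAlgebra ℝ V) = ExteriorAlgebra.map f.toLinearMap X)
      (fun w => ?_) (fun a b ha hb => ?_) (fun c a ha => ?_) X
    · simp [exteriorPower.map_apply_ιMulti]
    · simp [ha, hb]
    · simp [ha]
  rw [interior_apply, h1, pairing_compLinearMap, map_mul, ExteriorAlgebra.map_apply_ιMulti,
    ContinuousAlternatingMap.compContinuousLinearMap_apply, interior_apply, h2]
  rfl

end Interior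

section Manifold
variable (m : ℕ) {M : Type*} [TopologicalSpace M] [ChartedSpace (EuclideanSpace ℝ (Fin m)) M]

/-- The fibre at `x` of the graded Pontryagin bundle: pairs of an `r`-vector and a `k`-covector
at `x`, i.e. `Λ^r T_xM ⊕ Λ^k T_x^*M`. The bundle `P_r` of degree `n + 1` has `r + k = n + 2`. -/
abbrev Pont (r k : ℕ) (x : M) : Type :=
  (⋀[ℝ]^r (TangentSpace (𝓡 m) x)) × (TangentSpace (𝓡 m) x [⋀^Fin k]→L[ℝ] ℝ)

variable (M) in
/-- (Not necessarily smooth) fields of `r`-vectors on `M`. -/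
abbrev MultivectorField (r : ℕ) : Type _ := (x : M) → ⋀[ℝ]^r (TangentSpace (𝓡 m) x)

variable (M) in
/-- (Not necessarily smooth) differential `k`-forms on `M`. -/
abbrev DiffForm (k : ℕ) : Type _ := (x : M) → TangentSpace (𝓡 m) x [⋀^Fin k]→L[ℝ] ℝ

/-- The differential at `x` of the preferred chart around `x₀`. -/
def toChart (x₀ x : M) : TangentSpace (𝓡 m) x →L[ℝ] EuclideanSpace ℝ (Fin m) :=
  mfderiv (𝓡 m) (𝓡 m) (extChartAt (𝓡 m) x₀) x

/-- The inverse of the differential at `x` of the preferred chart around `x₀`. -/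
def fromChart (x₀ x : M) : EuclideanSpace ℝ (Fin m) →L[ℝ] TangentSpace (𝓡 m) x :=
  (toChart m x₀ x).inverse

variable {m}

/-- The expression of a multivector field in the preferred chart around `x₀`. -/
def MultivectorField.inChart {r : ℕ} (X : MultivectorField m M r) (x₀ : M)
    (y : EuclideanSpace ℝ (Fin m)) : ⋀[ℝ]^r (EuclideanSpace ℝ (Fin m)) :=
  exteriorPower.map r (toChart m x₀ ((extChartAt (𝓡 m) x₀).symm y)).toLinearMap
    (X ((extChartAt (𝓡 m) x₀).symm y))

/-- The expression of a differential form in the preferred chart around `x₀`. -/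
def DiffForm.inChart {k : ℕ} (η : DiffForm m M k) (x₀ : M)
    (y : EuclideanSpace ℝ (Fin m)) : EuclideanSpace ℝ (Fin m) [⋀^Fin k]→L[ℝ] ℝ :=
  (η ((extChartAt (𝓡 m) x₀).symm y)).compContinuousLinearMap
    (fromChart m x₀ ((extChartAt (𝓡 m) x₀).symm y))

/-- Smoothness of a multivector field: it is smooth in charts. -/
def MultivectorField.IsSmooth {r : ℕ} (X : MultivectorField m M r) : Prop :=
  ∀ x₀ : M, ContDiffOn ℝ ∞ (X.inChart x₀) (extChartAt (𝓡 m) x₀).target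

/-- Smoothness of a differential form: it is smooth in charts. -/
def DiffForm.IsSmooth {k : ℕ} (η : DiffForm m M k) : Prop :=
  ∀ x₀ : M, ContDiffOn ℝ ∞ (η.inChart x₀) (extChartAt (𝓡 m) x₀).target

/-- The exterior derivative, computed at `x` in the preferred chart around `x`. -/
def DiffForm.d {k : ℕ} (η : DiffForm m M k) : DiffForm m M (k + 1) := fun x =>
  (extDeriv (η.inChart x) (extChartAt (𝓡 m) x x)).compContinuousLinearMap (toChart m x x)

/-- The interior product `i_X η` of a field of `r`-vectors and an `(r + q)`-form. -/
def interiorProduct {r k q : ℕ} (X : MultivectorField m M r) (η : DiffForm m M k) :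
    DiffForm m M q := fun x => interior (X x) (η x)

/-- The Lie derivative `£_X η = i_X dη - (-1)^r d i_X η` of an `(r + q)`-form along a field of
`r`-vectors. -/
def lieDerivative {r q : ℕ} (X : MultivectorField m M r) (η : DiffForm m M (r + q)) :
    DiffForm m M (q + 1) :=
  (interiorProduct X η.d : DiffForm m M (q + 1))
    - (-1 : ℝ) ^ r • (interiorProduct X η : DiffForm m M q).d

/-- The Schouten-Nijenhuis bracket on the open subsets of `ℝ^m`:
`[X, Y] = ∑ a, ∂_a Y ∧ (dx^a ⌟ X) - (-1)^((r-1)(s-1)) ∂_a X ∧ (dx^a ⌟ Y)`.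
For vector fields `X_i`, `Y_j` this gives
`[X_1 ∧ ⋯ ∧ X_r, Y_1 ∧ ⋯ ∧ Y_s] = ∑ i j, (-1)^(i+j) [X_i, Y_j] ∧ Y_1 ⋯ Ŷ_j ⋯ Y_s ∧ X_1 ⋯ X̂_i ⋯ X_r`,
and the bracket is normalised so that `i_[X,Y] = £_X i_Y - (-1)^((r-1)s) i_Y £_X`. -/
def flatSchouten {r s : ℕ} (hr : 1 ≤ r) (hs : 1 ≤ s)
    (X : EuclideanSpace ℝ (Fin m) → ⋀[ℝ]^r (EuclideanSpace ℝ (Fin m)))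
    (Y : EuclideanSpace ℝ (Fin m) → ⋀[ℝ]^s (EuclideanSpace ℝ (Fin m)))
    (y : EuclideanSpace ℝ (Fin m)) : ⋀[ℝ]^(r + s - 1) (EuclideanSpace ℝ (Fin m)) :=
  ⟨∑ a : Fin m,
    ((fderiv ℝ Y y (EuclideanSpace.single a 1) : ExteriorAlgebra ℝ (EuclideanSpace ℝ (Fin m)))
        * contract (EuclideanSpace.proj a).toLinearMap (X y)
      - (-1 : ℝ) ^ ((r - 1) * (s - 1)) •
      ((fderiv ℝ X y (EuclideanSpace.single a 1) : ExteriorAlgebra ℝ (EuclideanSpace ℝ (Fin m)))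
        * contract (EuclideanSpace.proj a).toLinearMap (Y y))), by
    refine Submodule.sum_mem _ fun a _ => Submodule.sub_mem _ (wedge_contract_mem _ hr _ _)
      (Submodule.smul_mem _ _ ?_)
    rw [add_comm r s]
    exact wedge_contract_mem _ hs _ _⟩

/-- The Schouten-Nijenhuis bracket of multivector fields on `M`, computed at `x` in the preferred
chart around `x`. -/
def schouten {r s : ℕ} (hr : 1 ≤ r) (hs : 1 ≤ s) (X : MultivectorField m M r)
    (Y : MultivectorField m M s) : MultivectorField m M (r + s - 1) := fun x =>
  exteriorPower.map (r + s - 1) (fromChart m x x).toLinearMap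
    (flatSchouten hr hs (X.inChart x) (Y.inChart x) (extChartAt (𝓡 m) x x))

/-- The multi-Courant bracket `[[(X, Σ), (Y, Σ')]]_{r,s}` of `(X, Σ) ∈ Γ(P_r)` and
`(Y, Σ') ∈ Γ(P_s)`, where `r + s + q = n + 2`. -/
def multiCourant {r s q : ℕ} (hr : 1 ≤ r) (hs : 1 ≤ s)
    (X : MultivectorField m M r) (S : DiffForm m M (s + q))
    (Y : MultivectorField m M s) (T : DiffForm m M (r + q)) (x : M) :
    Pont m (r + s - 1) (q + 1) x :=
  (schouten hr hs X Y x,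
    (lieDerivative X T - (-1 : ℝ) ^ ((r - 1) * (s - 1)) • lieDerivative Y S
      + ((-1 : ℝ) ^ r / 2) • ((interiorProduct X T : DiffForm m M q)
          + (-1 : ℝ) ^ (r * s) • (interiorProduct Y S : DiffForm m M q)).d) x)

/-- The antisymmetric pairing `½ (i_Y Σ - (-1)^(rs) i_X Σ')` of `(X, Σ) ∈ P_r` and
`(Y, Σ') ∈ P_s`, where `r + s + q = n + 2`. -/
def antisymPairing {r s q : ℕ} {x : M} (p : Pont m r (s + q) x) (p' : Pont m s (r + q) x) :
    TangentSpace (𝓡 m) x [⋀^Fin q]→L[ℝ] ℝ :=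
  (1 / 2 : ℝ) • (interior p'.1 p.2 - (-1 : ℝ) ^ (r * s) • interior p.1 p'.2)

/-- A family of subspaces of the fibres of `P_r` is a smooth subbundle if around each point it has
a local frame of smooth sections. -/
def IsSmoothSubbundle {r k : ℕ} (D : (x : M) → Submodule ℝ (Pont m r k x)) : Prop :=
  ∀ x₀ : M, ∃ U : Set M, IsOpen U ∧ x₀ ∈ U ∧ U ⊆ (extChartAt (𝓡 m) x₀).source ∧
    ∃ (d : ℕ) (X : Fin d → MultivectorField m M r) (S : Fin d → DiffForm m M k),
      (∀ i, ContDiffOn ℝ ∞ ((X i).inChart x₀) (extChartAt (𝓡 m) x₀ '' U)) ∧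
      (∀ i, ContDiffOn ℝ ∞ ((S i).inChart x₀) (extChartAt (𝓡 m) x₀ '' U)) ∧
      ∀ x ∈ U, LinearIndependent ℝ (fun i => ((X i x, S i x) : Pont m r k x)) ∧
        Submodule.span ℝ (Set.range fun i => ((X i x, S i x) : Pont m r k x)) = D x

variable (m M) in
/-- An almost multi-Dirac structure `D_1, …, D_{n+1}` of degree `n + 1` on `M`. The subbundle
`D_r ⊆ P_r` is `D r k` with `r + k = n + 2`, `1 ≤ r`, `1 ≤ k`; other values of `r`, `k` are
irrelevant. -/
structure AlmostMultiDirac (n : ℕ) where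
  D : (r k : ℕ) → (x : M) → Submodule ℝ (Pont m r k x)
  smooth : ∀ r k, 1 ≤ r → 1 ≤ k → r + k = n + 2 → IsSmoothSubbundle (D r k)
  /-- `D_r` is the `r`-orthogonal complement of `D_s`. -/
  lagrangian : ∀ r s q, 1 ≤ r → 1 ≤ s → r + s + q = n + 2 → ∀ (x : M) (p : Pont m r (s + q) x),
    p ∈ D r (s + q) x ↔ ∀ p' ∈ D s (r + q) x, antisymPairing p p' = 0

/-- The sections of `D` of degrees `r, s` with `r + s ≤ N` are closed under the multi-Courant
bracket. -/
def AlmostMultiDirac.IsIntegrableUpTo {n : ℕ} (A : AlmostMultiDirac m M n) (N : ℕ) : Prop :=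
  ∀ (r s q : ℕ) (hr : 1 ≤ r) (hs : 1 ≤ s), r + s + q = n + 2 → r + s ≤ N →
    ∀ (X : MultivectorField m M r) (S : DiffForm m M (s + q))
      (Y : MultivectorField m M s) (T : DiffForm m M (r + q)),
      X.IsSmooth → S.IsSmooth → Y.IsSmooth → T.IsSmooth →
      (∀ x, (X x, S x) ∈ A.D r (s + q) x) → (∀ x, (Y x, T x) ∈ A.D s (r + q) x) →
      ∀ x, multiCourant hr hs X S Y T x ∈ A.D (r + s - 1) (q + 1) x

/-- The graph `{(X, Σ) | i_X Ω = Σ}` of an `l`-covector `Ω` at `x`. -/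
def graphFibre {l : ℕ} (Ω : DiffForm m M l) (r k : ℕ) (x : M) : Submodule ℝ (Pont m r k x) where
  carrier := {p | interior p.1 (Ω x) = p.2}
  add_mem' := by
    intro a b ha hb
    simp only [Set.mem_ofPred_eq] at ha hb ⊢
    rw [Prod.fst_add, Prod.snd_add, interior_add, ha, hb]
  zero_mem' := by
    have := interior_smul (q := k) (0 : ℝ) (0 : ⋀[ℝ]^r (TangentSpace (𝓡 m) x)) (Ω x)
    simpa using this
  smul_mem' := by
    intro c a ha
    simp only [Set.mem_ofPred_eq] at ha ⊢
    rw [Prod.smul_fst, Prod.smul_snd, interior_smul, ha]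

theorem mem_graphFibre {l : ℕ} (Ω : DiffForm m M l) {r k : ℕ} {x : M} (p : Pont m r k x) :
    p ∈ graphFibre Ω r k x ↔ interior p.1 (Ω x) = p.2 := Iff.rfl

theorem graphFibre_lagrangian {l : ℕ} (Ω : DiffForm m M l) {r s q : ℕ} (h : r + s + q = l) (x : M)
    (p : Pont m r (s + q) x) :
    p ∈ graphFibre Ω r (s + q) x ↔ ∀ p' ∈ graphFibre Ω s (r + q) x, antisymPairing p p' = 0 := by
  have key : ∀ Y : ⋀[ℝ]^s (TangentSpace (𝓡 m) x),
      (interior Y (interior p.1 (Ω x) : TangentSpace (𝓡 m) x [⋀^Fin (s + q)]→L[ℝ] ℝ) :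
        TangentSpace (𝓡 m) x [⋀^Fin q]→L[ℝ] ℝ) = (-1 : ℝ) ^ (r * s) • interior p.1
        (interior Y (Ω x) : TangentSpace (𝓡 m) x [⋀^Fin (r + q)]→L[ℝ] ℝ) := fun Y =>
    interior_interior p.1 Y (Ω x) (by omega) (by omega)
  rw [mem_graphFibre]
  constructor
  · rintro hp ⟨Y, T⟩ hp'
    rw [mem_graphFibre] at hp'
    simp only at hp'
    rw [antisymPairing, ← hp, ← hp', key, sub_self, smul_zero]
  · intro hp
    rw [← sub_eq_zero]
    refine eq_zero_of_interior_eq_zero rfl _ (q := q) (s := s) fun Y => ?_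
    have h1 := hp (Y, interior Y (Ω x)) rfl
    rw [antisymPairing, smul_eq_zero, or_iff_right (by norm_num), ← key, sub_eq_zero] at h1
    rw [sub_eq_add_neg, ← neg_one_smul ℝ p.2, interior_add_right, interior_smul_right, h1]
    ext v
    rw [ContinuousAlternatingMap.add_apply, ContinuousAlternatingMap.smul_apply, smul_eq_mul,
      neg_one_mul, add_neg_cancel]
    rfl

theorem finiteDimensional_covector (k : ℕ) :
    FiniteDimensional ℝ (EuclideanSpace ℝ (Fin m) [⋀^Fin k]→L[ℝ] ℝ) :=
  FiniteDimensional.of_injective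
    (AlternatingMap.toMultilinearMapLM (S := ℝ) ∘ₗ ContinuousAlternatingMap.toAlternatingMapLinear)
    (AlternatingMap.coe_multilinearMap_injective.comp
      ContinuousAlternatingMap.toAlternatingMap_injective)

theorem contDiffOn_interior {r k q : ℕ} (X : ⋀[ℝ]^r (EuclideanSpace ℝ (Fin m)))
    {η : EuclideanSpace ℝ (Fin m) → EuclideanSpace ℝ (Fin m) [⋀^Fin k]→L[ℝ] ℝ}
    {s : Set (EuclideanSpace ℝ (Fin m))} (h : ContDiffOn ℝ ∞ η s) :
    ContDiffOn ℝ ∞ (fun y => (interior X (η y) : EuclideanSpace ℝ (Fin m) [⋀^Fin q]→L[ℝ] ℝ)) s := by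
  have := finiteDimensional_covector (m := m) k
  let L : (EuclideanSpace ℝ (Fin m) [⋀^Fin k]→L[ℝ] ℝ) →ₗ[ℝ]
      (EuclideanSpace ℝ (Fin m) [⋀^Fin q]→L[ℝ] ℝ) :=
    { toFun := fun α => interior X α
      map_add' := interior_add_right X
      map_smul' := interior_smul_right X }
  exact (LinearMap.toContinuousLinearMap L).contDiff.comp_contDiffOn h

variable [IsManifold (𝓡 m) ∞ M]

theorem toChart_fromChart {x₀ x : M} (hx : x ∈ (extChartAt (𝓡 m) x₀).source) :
    (toChart m x₀ x).toLinearMap ∘ₗ (fromChart m x₀ x).toLinearMap = LinearMap.id := by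
  have : IsManifold (𝓡 m) 1 M := IsManifold.of_le (n := ∞) (by simp)
  have hinv : (toChart m x₀ x).IsInvertible := isInvertible_mfderiv_extChartAt hx
  obtain ⟨e, he⟩ := hinv
  ext v
  simp [fromChart, ← he]

theorem fromChart_toChart {x₀ x : M} (hx : x ∈ (extChartAt (𝓡 m) x₀).source) :
    (fromChart m x₀ x).toLinearMap ∘ₗ (toChart m x₀ x).toLinearMap = LinearMap.id := by
  have : IsManifold (𝓡 m) 1 M := IsManifold.of_le (n := ∞) (by simp)
  have hinv : (toChart m x₀ x).IsInvertible := isInvertible_mfderiv_extChartAt hx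
  obtain ⟨e, he⟩ := hinv
  ext v
  simp [fromChart, ← he]

theorem graphFibre_smooth {l : ℕ} {Ω : DiffForm m M l} (hΩ : Ω.IsSmooth) (r k : ℕ) :
    IsSmoothSubbundle (graphFibre Ω r k) := by
  intro x₀
  let b := Module.finBasis ℝ (⋀[ℝ]^r (EuclideanSpace ℝ (Fin m)))
  have hto : ∀ x ∈ (extChartAt (𝓡 m) x₀).source, ∀ v,
      exteriorPower.map r (toChart m x₀ x).toLinearMap
        (exteriorPower.map r (fromChart m x₀ x).toLinearMap v) = v := fun x hx v => by
    rw [← LinearMap.comp_apply, ← exteriorPower.map_comp, toChart_fromChart hx,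
      exteriorPower.map_id, LinearMap.id_apply]
  have hfrom : ∀ x ∈ (extChartAt (𝓡 m) x₀).source, ∀ v,
      exteriorPower.map r (fromChart m x₀ x).toLinearMap
        (exteriorPower.map r (toChart m x₀ x).toLinearMap v) = v := fun x hx v => by
    rw [← LinearMap.comp_apply, ← exteriorPower.map_comp, fromChart_toChart hx,
      exteriorPower.map_id, LinearMap.id_apply]
  refine ⟨_, isOpen_extChartAt_source x₀, mem_extChartAt_source x₀, subset_rfl, _,
    fun i x => exteriorPower.map r (fromChart m x₀ x).toLinearMap (b i),
    fun i x => interior (exteriorPower.map r (fromChart m x₀ x).toLinearMap (b i)) (Ω x), ?_, ?_, ?_⟩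
  · intro i
    rw [(extChartAt (𝓡 m) x₀).image_source_eq_target]
    refine (contDiffOn_const (c := b i)).congr fun y hy => ?_
    exact hto _ ((extChartAt (𝓡 m) x₀).map_target hy) _
  · intro i
    rw [(extChartAt (𝓡 m) x₀).image_source_eq_target]
    refine (contDiffOn_interior (b i) (hΩ x₀)).congr fun y hy => ?_
    exact (interior_compContinuousLinearMap _ _ _).symm
  · intro x hx
    let f : ⋀[ℝ]^r (EuclideanSpace ℝ (Fin m)) →ₗ[ℝ] Pont m r k x :=
      { toFun := fun v => (exteriorPower.map r (fromChart m x₀ x).toLinearMap v,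
          interior (exteriorPower.map r (fromChart m x₀ x).toLinearMap v) (Ω x))
        map_add' := fun v w => by rw [map_add, interior_add, Prod.mk_add_mk]
        map_smul' := fun c v => by rw [map_smul, interior_smul]; rfl }
    have hf : LinearMap.ker f = ⊥ := by
      rw [LinearMap.ker_eq_bot]
      intro v w hvw
      have := congrArg (fun p => exteriorPower.map r (toChart m x₀ x).toLinearMap p.1) hvw
      simpa [f, hto x hx] using this
    refine ⟨b.linearIndependent.map' f hf, ?_⟩
    have : (Set.range fun i => f (b i)) = f '' Set.range b := by
      rw [← Set.range_comp]; rfl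
    change Submodule.span ℝ (Set.range fun i => f (b i)) = _
    rw [this, Submodule.span_image, b.span_eq, Submodule.map_top]
    ext p
    rw [LinearMap.mem_range, mem_graphFibre]
    constructor
    · rintro ⟨v, rfl⟩
      rfl
    · intro hp
      refine ⟨exteriorPower.map r (toChart m x₀ x).toLinearMap p.1, ?_⟩
      refine Prod.ext ?_ ?_
      · exact hfrom x hx p.1
      · change interior _ (Ω x) = _
        rw [hfrom x hx, hp]

/-- The almost multi-Dirac structure of degree `n + 1` given by the graph of an `(n + 2)`-form:
`D_r = {(X, Σ) ∈ P_r | i_X Ω = Σ}`. -/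
def graphMultiDirac {n : ℕ} (Ω : DiffForm m M (n + 2)) (hΩ : Ω.IsSmooth) :
    AlmostMultiDirac m M n where
  D := graphFibre Ω
  smooth r k _ _ _ := graphFibre_smooth hΩ r k
  lagrangian _ _ _ _ _ h x p := graphFibre_lagrangian Ω h x p

end Manifold
end MultiDirac

end

/-!
Sections of the graph of `Ω` are the pairs `(X, i_X Ω)`. For two of them, of degrees `r` and `s`, the
two summands of the symmetric term of the multi-Courant bracket agree, and its form part reduces to
`i_X d i_Y Ω - (-1)^((r-1)(s-1)) i_Y d i_X Ω - (-1)^r d i_X i_Y Ω`. By the Cartan calculus of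
multivector fields this equals `i_[X,Y] Ω + (-1)^((r-1)s) i_Y i_X dΩ` (`interior_flatSchouten` and
`multiCourant_graph_snd`). The bracket therefore lies in the graph exactly when `i_Y i_X dΩ = 0`
(`multiCourant_mem_graphFibre_iff`).

If `dΩ = 0`, this holds for all `X` and `Y`. Conversely, closure under brackets of degrees
`r = s = 1` suffices: every tangent vector extends to a smooth vector field
(`exists_isSmooth_eq_of_one`), and a covector whose contractions with all pairs of vectors vanish is
zero. These degrees occur as soon as the integrability bound is at least `2`.

The Cartan identity is a statement about 1-jets at a point of `ℝ^m`. Regarding a `k`-form as a linear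
functional on multivectors, `dω = ∑ a, ∂_a ω ∘ (dx^a ⌟ ·)` (`pairing_extDeriv`), so that for each
coordinate `a` the identity follows from the antiderivation rule for contraction (`contract_mul`) and
graded commutativity of the wedge product. The exterior derivative and the Schouten bracket at `x` are
both computed in the chart around `x`, so no change of charts enters there.
-/

namespace MultiDirac

/-! ### Contraction and the interior product -/

section Algebra
variable {V : Type*} [AddCommGroup V] [Module ℝ V]

theorem contract_ι_mul (ξ : Module.Dual ℝ V) (v : V) (Z : ExteriorAlgebra ℝ V) :
    contract ξ (ExteriorAlgebra.ι ℝ v * Z) = ξ v • Z - ExteriorAlgebra.ι ℝ v * contract ξ Z :=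
  CliffordAlgebra.contractLeft_ι_mul _ _ _

theorem contract_one (ξ : Module.Dual ℝ V) : contract ξ (1 : ExteriorAlgebra ℝ V) = 0 :=
  CliffordAlgebra.contractLeft_one (Q := (0 : QuadraticForm ℝ V)) ξ

/-- Contraction with a covector is an antiderivation of the exterior algebra. -/
theorem contract_mul (ξ : Module.Dual ℝ V) {r : ℕ} (X : ⋀[ℝ]^r V) (Z : ExteriorAlgebra ℝ V) :
    contract ξ (X * Z)
      = contract ξ X * Z + (-1 : ℝ) ^ r • ((X : ExteriorAlgebra ℝ V) * contract ξ Z) := by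
  refine decomposable_induction (fun v => ?_) (fun a b ha hb => ?_) (fun c a ha => ?_) X
  · rw [exteriorPower.ιMulti_apply_coe]
    induction r with
    | zero => simp [contract_one]
    | succ r ih =>
      rw [ExteriorAlgebra.ιMulti_succ_apply, mul_assoc, contract_ι_mul, ih 0, contract_ι_mul]
      simp only [mul_add, sub_mul, smul_mul_assoc, mul_smul_comm, mul_assoc, pow_succ]
      module
  · simp only [Submodule.coe_add, add_mul, map_add, ha, hb, smul_add]
    abel
  · simp only [Submodule.coe_smul, smul_mul_assoc, map_smul, ha, smul_add]
    rw [smul_comm]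

theorem contract_ιMulti_succ (ξ : Module.Dual ℝ V) {k : ℕ} (v : Fin (k + 1) → V) :
    contract ξ (ExteriorAlgebra.ιMulti ℝ (k + 1) v)
      = ∑ i : Fin (k + 1), ((-1 : ℝ) ^ (i : ℕ) * ξ (v i)) •
          ExteriorAlgebra.ιMulti ℝ k (i.removeNth v) := by
  induction k with
  | zero =>
    have : contract ξ (ExteriorAlgebra.ι ℝ (v 0)) = algebraMap ℝ _ (ξ (v 0)) :=
      CliffordAlgebra.contractLeft_ι _ _ _
    simp [this, Algebra.algebraMap_eq_smul_one]
  | succ k ih =>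
    rw [ExteriorAlgebra.ιMulti_succ_apply, contract_ι_mul, ih,
      Fin.sum_univ_succ (n := k + 1), Finset.mul_sum,
      sub_eq_add_neg, ← Finset.sum_neg_distrib]
    congr 1
    · simp [Fin.removeNth_zero, Matrix.vecTail, Fin.tail_def, Function.comp_def]
    · refine Finset.sum_congr rfl fun i _ => ?_
      have h0 : i.succ.removeNth v 0 = v 0 := by simp [Fin.removeNth]
      have h1 : Matrix.vecTail (i.succ.removeNth v) = i.removeNth (Matrix.vecTail v) := by
        ext j
        simp [Matrix.vecTail, Fin.removeNth]
      rw [ExteriorAlgebra.ιMulti_succ_apply, h0, h1, mul_smul_comm, ← neg_smul]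
      congr 1
      simp [Matrix.vecTail, pow_succ]

/-- Contraction with a covector lowers the degree, so it is compatible with the convention that a
covector vanishes on multivectors of a degree different from its own. -/
theorem pairing_contract_ιMulti_of_ne (ξ : Module.Dual ℝ V) {k l : ℕ} (h : l ≠ k + 1)
    (α : V [⋀^Fin k]→ₗ[ℝ] ℝ) (v : Fin l → V) :
    pairing α (contract ξ (ExteriorAlgebra.ιMulti ℝ l v)) = 0 := by
  cases l with
  | zero => simp [contract_one]
  | succ l =>
    rw [contract_ιMulti_succ, map_sum]
    refine Finset.sum_eq_zero fun i _ => ?_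
    rw [map_smul, pairing_ιMulti_of_ne (by omega), smul_zero]

theorem interior_zero_right [TopologicalSpace V] {r k q : ℕ}
    (X : ⋀[ℝ]^r V) : (interior X (0 : V [⋀^Fin k]→L[ℝ] ℝ) : V [⋀^Fin q]→L[ℝ] ℝ) = 0 := by
  simpa using interior_smul_right (q := q) X 0 (0 : V [⋀^Fin k]→L[ℝ] ℝ)

end Algebra

/-! ### Cartan calculus on `ℝ^m` -/

section Flat
variable {m : ℕ}

local notation "E" => EuclideanSpace ℝ (Fin m)

/-- The interior product on `ℝ^m` as a continuous bilinear map. -/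
noncomputable def interiorCLM (r k q : ℕ) :
    ⋀[ℝ]^r E →L[ℝ] (E [⋀^Fin k]→L[ℝ] ℝ) →L[ℝ] (E [⋀^Fin q]→L[ℝ] ℝ) :=
  haveI := finiteDimensional_covector (m := m) k
  LinearMap.toContinuousBilinearMap
    (LinearMap.mk₂ ℝ (fun X α => interior X α) interior_add interior_smul interior_add_right
      fun c X α => interior_smul_right X c α)

theorem differentiableAt_interior {r k q : ℕ} {X : E → ⋀[ℝ]^r E} {η : E → E [⋀^Fin k]→L[ℝ] ℝ}
    {y : E} (hX : DifferentiableAt ℝ X y) (hη : DifferentiableAt ℝ η y) :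
    DifferentiableAt ℝ (fun z => (interior (X z) (η z) : E [⋀^Fin q]→L[ℝ] ℝ)) y :=
  ((interiorCLM r k q).hasFDerivAt_of_bilinear hX.hasFDerivAt hη.hasFDerivAt).differentiableAt

theorem fderiv_interior {r k q : ℕ} {X : E → ⋀[ℝ]^r E} {η : E → E [⋀^Fin k]→L[ℝ] ℝ}
    {y : E} (hX : DifferentiableAt ℝ X y) (hη : DifferentiableAt ℝ η y) (v : E) :
    fderiv ℝ (fun z => (interior (X z) (η z) : E [⋀^Fin q]→L[ℝ] ℝ)) y v
      = interior (X y) (fderiv ℝ η y v) + interior (fderiv ℝ X y v) (η y) :=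
  congrArg (fun L => L v) ((interiorCLM r k q).fderiv_of_bilinear hX hη)

/-- In terms of the linear functionals on multivectors that they define,
`dη = ∑ a, ∂_a η ∘ (dx^a ⌟ ·)`. -/
theorem pairing_extDeriv {k : ℕ} (η : E → E [⋀^Fin k]→L[ℝ] ℝ) (y : E) (Z : ExteriorAlgebra ℝ E) :
    pairing (extDeriv η y).toAlternatingMap Z
      = ∑ a : Fin m, pairing (fderiv ℝ η y (EuclideanSpace.single a 1)).toAlternatingMap
          (contract (EuclideanSpace.proj a : E →L[ℝ] ℝ).toLinearMap Z) := by
  have : pairing (extDeriv η y).toAlternatingMap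
      = ∑ a : Fin m, pairing (fderiv ℝ η y (EuclideanSpace.single a 1)).toAlternatingMap ∘ₗ
          contract (EuclideanSpace.proj a : E →L[ℝ] ℝ).toLinearMap := by
    apply ExteriorAlgebra.lhom_ext
    intro l
    ext v
    simp only [LinearMap.compAlternatingMap_apply, LinearMap.sum_apply, LinearMap.comp_apply]
    by_cases h : l = k + 1
    · subst h
      rw [pairing_ιMulti]
      simp only [contract_ιMulti_succ, map_sum, map_smul, pairing_ιMulti]
      rw [Finset.sum_comm]
      change extDeriv η y v = _
      rw [extDeriv, ContinuousAlternatingMap.alternatizeUncurryFin_apply]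
      refine Finset.sum_congr rfl fun i _ => ?_
      have hv : v i = ∑ a, v i a • EuclideanSpace.single a (1 : ℝ) := by
        ext b; simp [Pi.single_apply]
      conv_lhs => rw [hv]
      rw [map_sum, ContinuousAlternatingMap.sum_apply, Finset.smul_sum]
      refine Finset.sum_congr rfl fun a _ => ?_
      rw [map_smul, ContinuousAlternatingMap.smul_apply]
      simp [mul_assoc]
    · rw [pairing_ιMulti_of_ne h]
      exact (Finset.sum_eq_zero fun a _ => pairing_contract_ιMulti_of_ne _ h _ _).symm
  rw [this]
  simp

theorem pairing_extDeriv_interior {r k q : ℕ} (h : r + q = k) {X : E → ⋀[ℝ]^r E}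
    {η : E → E [⋀^Fin k]→L[ℝ] ℝ} {y : E} (hX : DifferentiableAt ℝ X y)
    (hη : DifferentiableAt ℝ η y) (Z : ExteriorAlgebra ℝ E) :
    pairing (extDeriv (fun z => (interior (X z) (η z) : E [⋀^Fin q]→L[ℝ] ℝ)) y).toAlternatingMap Z
      = ∑ a : Fin m, (pairing (fderiv ℝ η y (EuclideanSpace.single a 1)).toAlternatingMap
            (X y * contract (EuclideanSpace.proj a : E →L[ℝ] ℝ).toLinearMap Z)
          + pairing (η y).toAlternatingMap
            ((fderiv ℝ X y (EuclideanSpace.single a 1) : ExteriorAlgebra ℝ E)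
              * contract (EuclideanSpace.proj a : E →L[ℝ] ℝ).toLinearMap Z)) := by
  rw [pairing_extDeriv]
  refine Finset.sum_congr rfl fun a _ => ?_
  rw [fderiv_interior hX hη, ← pairing_interior _ _ h, ← pairing_interior _ _ h,
    ← LinearMap.add_apply, ← pairing_add]
  rfl

/-- The Cartan calculus behind the multi-Courant bracket of two sections of a graph,
`i_X d i_Y η - (-1)^((r-1)(s-1)) i_Y d i_X η - (-1)^r d i_X i_Y η
  = i_[X,Y] η + (-1)^((r-1)s) i_Y i_X dη`, at a point of `ℝ^m`. -/
theorem interior_flatSchouten {r s q k : ℕ} (hr : 1 ≤ r) (hs : 1 ≤ s) (h : r + s + q = k)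
    {X : E → ⋀[ℝ]^r E} {Y : E → ⋀[ℝ]^s E} {η : E → E [⋀^Fin k]→L[ℝ] ℝ} {y : E}
    (hX : DifferentiableAt ℝ X y) (hY : DifferentiableAt ℝ Y y) (hη : DifferentiableAt ℝ η y) :
    (interior (X y) (extDeriv (fun z => (interior (Y z) (η z) : E [⋀^Fin (r + q)]→L[ℝ] ℝ)) y)
        - (-1 : ℝ) ^ ((r - 1) * (s - 1)) • interior (Y y)
          (extDeriv (fun z => (interior (X z) (η z) : E [⋀^Fin (s + q)]→L[ℝ] ℝ)) y)
        - (-1 : ℝ) ^ r • extDeriv (fun z => (interior (X z)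
          (interior (Y z) (η z) : E [⋀^Fin (r + q)]→L[ℝ] ℝ) : E [⋀^Fin q]→L[ℝ] ℝ)) y)
      = interior (flatSchouten hr hs X Y y) (η y)
        + (-1 : ℝ) ^ ((r - 1) * s) • (interior (Y y)
          (interior (X y) (extDeriv η y) : E [⋀^Fin (s + q + 1)]→L[ℝ] ℝ)) := by
  ext v
  simp only [ContinuousAlternatingMap.add_apply, ContinuousAlternatingMap.sub_apply,
    ContinuousAlternatingMap.smul_apply, smul_eq_mul]
  simp only [interior_apply]
  -- Both sides become values of linear functionals at the multivector `Z = v 0 ∧ ⋯ ∧ v q`.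
  have hd : extDeriv (fun z => (interior (X z)
      (interior (Y z) (η z) : E [⋀^Fin (r + q)]→L[ℝ] ℝ) : E [⋀^Fin q]→L[ℝ] ℝ)) y v
      = pairing (extDeriv (fun z => (interior (X z)
        (interior (Y z) (η z) : E [⋀^Fin (r + q)]→L[ℝ] ℝ) : E [⋀^Fin q]→L[ℝ] ℝ)) y).toAlternatingMap
          (ExteriorAlgebra.ιMulti ℝ (q + 1) v) := by
    rw [pairing_ιMulti]; rfl
  rw [hd, pairing_interior (X y) (extDeriv η y) (by omega)]
  generalize ExteriorAlgebra.ιMulti ℝ (q + 1) v = Z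
  rw [pairing_extDeriv_interior (by omega) hY hη, pairing_extDeriv_interior (by omega) hX hη,
    pairing_extDeriv_interior rfl hX (differentiableAt_interior hY hη), pairing_extDeriv]
  simp only [fderiv_interior hY hη, flatSchouten, Finset.sum_mul, map_sum, Finset.mul_sum]
  simp only [← Finset.sum_sub_distrib, ← Finset.sum_add_distrib]
  refine Finset.sum_congr rfl fun a _ => ?_
  -- The identity holds for each coordinate `a` separately, where it is one of multivectors: only
  -- the values and the `a`-th partial derivatives of `X`, `Y` and `η` at `y` enter.
  have hadd : ∀ (α β : E [⋀^Fin (r + q)]→L[ℝ] ℝ) (W : ExteriorAlgebra ℝ E),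
      pairing (α + β).toAlternatingMap W
        = pairing α.toAlternatingMap W + pairing β.toAlternatingMap W := fun α β W =>
    congrArg (fun f => f W) (pairing_add α.toAlternatingMap β.toAlternatingMap)
  rw [hadd, pairing_interior _ _ (by omega), pairing_interior _ _ (by omega),
    pairing_interior _ _ (by omega)]
  generalize fderiv ℝ X y (EuclideanSpace.single a 1) = X'
  generalize fderiv ℝ Y y (EuclideanSpace.single a 1) = Y'
  generalize pairing (fderiv ℝ η y (EuclideanSpace.single a 1)).toAlternatingMap = φ'
  generalize pairing (η y).toAlternatingMap = φ
  generalize (EuclideanSpace.proj a : E →L[ℝ] ℝ).toLinearMap = ξ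
  generalize X y = A
  generalize Y y = B
  clear hd hη hX hY h hadd
  obtain ⟨r, rfl⟩ : ∃ t, r = t + 1 := ⟨r - 1, by omega⟩
  obtain ⟨s, rfl⟩ : ∃ t, s = t + 1 := ⟨s - 1, by omega⟩
  -- By graded commutativity every product is a multiple of one in which the factors come in a fixed
  -- order; the coefficients of these are then compared.
  have hA : contract ξ A * (B : ExteriorAlgebra ℝ E)
      = (-1 : ℝ) ^ (r * (s + 1)) • ((B : ExteriorAlgebra ℝ E) * contract ξ A) :=
    wedge_comm ⟨_, contract_mem ξ A⟩ B
  have hB : (B : ExteriorAlgebra ℝ E) * X'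
      = (-1 : ℝ) ^ ((s + 1) * (r + 1)) • ((X' : ExteriorAlgebra ℝ E) * B) := wedge_comm B X'
  have hAB : (A : ExteriorAlgebra ℝ E) * (B * contract ξ Z)
      = (-1 : ℝ) ^ ((r + 1) * (s + 1)) • ((B : ExteriorAlgebra ℝ E) * (A * contract ξ Z)) := by
    rw [← mul_assoc, wedge_comm A B, smul_mul_assoc, mul_assoc]
  have hA' : contract ξ A * (B * Z)
      = (-1 : ℝ) ^ (r * (s + 1)) • ((B : ExteriorAlgebra ℝ E) * (contract ξ A * Z)) := by
    rw [← mul_assoc, hA, smul_mul_assoc, mul_assoc]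
  have hB' : (B : ExteriorAlgebra ℝ E) * (X' * contract ξ Z)
      = (-1 : ℝ) ^ ((s + 1) * (r + 1)) • ((X' : ExteriorAlgebra ℝ E) * (B * contract ξ Z)) := by
    rw [← mul_assoc, hB, smul_mul_assoc, mul_assoc]
  have e1 : ((-1 : ℝ) ^ r) ^ 2 = 1 := by rw [← pow_mul, mul_comm, pow_mul]; simp
  have e2 : ((-1 : ℝ) ^ (r * s)) ^ 2 = 1 := by rw [← pow_mul, mul_comm, pow_mul]; simp
  have p1 : (-1 : ℝ) ^ ((r + 1) * (s + 1)) = -((-1) ^ (r * s) * (-1) ^ r * (-1) ^ s) := by ring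
  have p2 : (-1 : ℝ) ^ ((s + 1) * (r + 1)) = -((-1) ^ (r * s) * (-1) ^ r * (-1) ^ s) := by ring
  have p3 : (-1 : ℝ) ^ (r * (s + 1)) = (-1) ^ (r * s) * (-1) ^ r := by ring
  rw [p1] at hAB
  rw [p2] at hB'
  rw [p3] at hA'
  simp only [contract_mul, mul_add, sub_mul, smul_mul_assoc, mul_smul_comm, map_add, map_sub,
    map_smul, smul_eq_mul, mul_assoc, hAB, hA', hB', add_tsub_cancel_right]
  linear_combination
    (-(φ' (B * (contract ξ A * Z)) * ((-1) ^ r) ^ 2)) * e2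
    + (-φ' (B * (contract ξ A * Z)) + (-1) ^ (r * s) * φ' (A * (contract ξ B * Z))
      + (-1) ^ r * ((-1) ^ (r * s)) ^ 2 * ((-1) ^ s) ^ 2 * φ' (B * (A * contract ξ Z))
      - (-1) ^ (r * s) * (-1) ^ s * φ (X' * (B * contract ξ Z))) * e1

end Flat

/-! ### The bracket of two sections of a graph -/

section Manifold
variable {m : ℕ} {M : Type*} [TopologicalSpace M] [ChartedSpace (EuclideanSpace ℝ (Fin m)) M]

local notation "E" => EuclideanSpace ℝ (Fin m)

theorem DiffForm.d_smul {k : ℕ} (c : ℝ) (η : DiffForm m M k) : (c • η).d = c • η.d := by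
  funext x
  have : (c • η).inChart x = c • η.inChart x := rfl
  rw [DiffForm.d, this, extDeriv_smul]
  rfl

theorem MultivectorField.inChart_self {r : ℕ} (X : MultivectorField m M r) (x : M) :
    X.inChart x (extChartAt (𝓡 m) x x) = exteriorPower.map r (toChart m x x).toLinearMap (X x) := by
  have : ∀ z, z = x → exteriorPower.map r (toChart m x z).toLinearMap (X z)
      = exteriorPower.map r (toChart m x x).toLinearMap (X x) := by
    rintro z rfl; rfl
  exact this _ (extChartAt_to_inv x)

theorem DiffForm.inChart_self {k : ℕ} (η : DiffForm m M k) (x : M) :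
    η.inChart x (extChartAt (𝓡 m) x x) = (η x).compContinuousLinearMap (fromChart m x x) := by
  have : ∀ z, z = x → (η z).compContinuousLinearMap (fromChart m x z)
      = (η x).compContinuousLinearMap (fromChart m x x) := by
    rintro z rfl; rfl
  exact this _ (extChartAt_to_inv x)

/-- At the centre `x` of a chart, the interior product with `X x` of a covector pulled back from the
chart is computed in the chart. -/
theorem interior_compContinuousLinearMap_toChart {r k q : ℕ} (X : MultivectorField m M r) (x : M)
    (α : E [⋀^Fin k]→L[ℝ] ℝ) :
    (interior (X x) (α.compContinuousLinearMap (toChart m x x)) :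
        TangentSpace (𝓡 m) x [⋀^Fin q]→L[ℝ] ℝ)
      = (interior (X.inChart x (extChartAt (𝓡 m) x x)) α).compContinuousLinearMap
          (toChart m x x) := by
  rw [X.inChart_self, interior_compContinuousLinearMap]

theorem MultivectorField.IsSmooth.differentiableAt {r : ℕ} {X : MultivectorField m M r}
    (hX : X.IsSmooth) (x : M) : DifferentiableAt ℝ (X.inChart x) (extChartAt (𝓡 m) x x) :=
  ((hX x).contDiffAt (extChartAt_target_mem_nhds x)).differentiableAt (by simp)

theorem DiffForm.IsSmooth.differentiableAt {k : ℕ} {η : DiffForm m M k}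
    (hη : η.IsSmooth) (x : M) : DifferentiableAt ℝ (η.inChart x) (extChartAt (𝓡 m) x x) :=
  ((hη x).contDiffAt (extChartAt_target_mem_nhds x)).differentiableAt (by simp)

theorem isOpen_coordChange_source (x x₀ : M) :
    IsOpen ((extChartAt (𝓡 m) x).symm ≫ extChartAt (𝓡 m) x₀).source :=
  (continuousOn_extChartAt_symm x).isOpen_inter_preimage (isOpen_extChartAt_target x)
    (isOpen_extChartAt_source x₀)

theorem mem_coordChange_source {x x₀ z : M} (hz : z ∈ (extChartAt (𝓡 m) x).source)
    (hz₀ : z ∈ (extChartAt (𝓡 m) x₀).source) :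
    extChartAt (𝓡 m) x z ∈ ((extChartAt (𝓡 m) x).symm ≫ extChartAt (𝓡 m) x₀).source := by
  rw [PartialEquiv.trans_source, PartialEquiv.symm_source]
  refine ⟨(extChartAt (𝓡 m) x).map_source hz, ?_⟩
  rwa [Set.mem_preimage, (extChartAt (𝓡 m) x).left_inv hz]

variable [IsManifold (𝓡 m) ∞ M]

theorem inChart_interiorProduct {r k q : ℕ} (X : MultivectorField m M r) (η : DiffForm m M k)
    (x₀ : M) {y : E} (hy : y ∈ (extChartAt (𝓡 m) x₀).target) :
    (interiorProduct X η : DiffForm m M q).inChart x₀ y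
      = interior (X.inChart x₀ y) (η.inChart x₀ y) := by
  have hz := (extChartAt (𝓡 m) x₀).map_target hy
  rw [DiffForm.inChart, DiffForm.inChart, interior_compContinuousLinearMap,
    MultivectorField.inChart, ← LinearMap.comp_apply (exteriorPower.map r _),
    ← exteriorPower.map_comp, fromChart_toChart hz, exteriorPower.map_id]
  rfl

theorem isSmooth_interiorProduct {r k q : ℕ} {X : MultivectorField m M r} {η : DiffForm m M k}
    (hX : X.IsSmooth) (hη : η.IsSmooth) : (interiorProduct X η : DiffForm m M q).IsSmooth :=
  fun x₀ => ContDiffOn.congr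
    ((interiorCLM r k q).isBoundedBilinearMap.contDiff.comp_contDiffOn ((hX x₀).prodMk (hη x₀)))
    fun _ hy => inChart_interiorProduct X η x₀ hy

/-- The exterior derivative of `i_X η` at `x` is computed from the expressions of `X` and `η` in the
chart around `x`. -/
theorem d_interiorProduct_apply {r k q : ℕ} (X : MultivectorField m M r) (η : DiffForm m M k)
    (x : M) :
    (interiorProduct X η : DiffForm m M q).d x
      = (extDeriv (fun z => (interior (X.inChart x z) (η.inChart x z) : E [⋀^Fin q]→L[ℝ] ℝ))
          (extChartAt (𝓡 m) x x)).compContinuousLinearMap (toChart m x x) := by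
  rw [DiffForm.d, Filter.EventuallyEq.extDeriv_eq]
  filter_upwards [extChartAt_target_mem_nhds x] with y hy
  exact inChart_interiorProduct X η x hy

theorem d_interiorProduct_interiorProduct_apply {r s k l q : ℕ} (X : MultivectorField m M r)
    (Y : MultivectorField m M s) (η : DiffForm m M k) (x : M) :
    (interiorProduct X (interiorProduct Y η : DiffForm m M l) : DiffForm m M q).d x
      = (extDeriv (fun z => (interior (X.inChart x z)
          (interior (Y.inChart x z) (η.inChart x z) : E [⋀^Fin l]→L[ℝ] ℝ) : E [⋀^Fin q]→L[ℝ] ℝ))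
          (extChartAt (𝓡 m) x x)).compContinuousLinearMap (toChart m x x) := by
  rw [d_interiorProduct_apply, Filter.EventuallyEq.extDeriv_eq]
  filter_upwards [extChartAt_target_mem_nhds x] with y hy
  rw [inChart_interiorProduct Y η x hy]

theorem interior_schouten {r s q k : ℕ} (hr : 1 ≤ r) (hs : 1 ≤ s) (X : MultivectorField m M r)
    (Y : MultivectorField m M s) (η : DiffForm m M k) (x : M) :
    (interior (schouten hr hs X Y x) (η x) : TangentSpace (𝓡 m) x [⋀^Fin q]→L[ℝ] ℝ)
      = (interior (flatSchouten hr hs (X.inChart x) (Y.inChart x) (extChartAt (𝓡 m) x x))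
          (η.inChart x (extChartAt (𝓡 m) x x))).compContinuousLinearMap (toChart m x x) := by
  rw [η.inChart_self, interior_compContinuousLinearMap]
  ext v
  rw [ContinuousAlternatingMap.compContinuousLinearMap_apply,
    ContinuousAlternatingMap.compContinuousLinearMap_apply]
  congr 1
  funext i
  exact (LinearMap.congr_fun (fromChart_toChart (mem_extChartAt_source (I := 𝓡 m) x)) (v i)).symm

/-- For sections `(X, i_X Ω)` and `(Y, i_Y Ω)` of the graph of `Ω`, the form part of the
multi-Courant bracket is `i_[X,Y] Ω + (-1)^((r-1)s) i_Y i_X dΩ`. -/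
theorem multiCourant_graph_snd {r s q k : ℕ} (hr : 1 ≤ r) (hs : 1 ≤ s) (h : r + s + q = k)
    {X : MultivectorField m M r} {Y : MultivectorField m M s} {Ω : DiffForm m M k}
    (hX : X.IsSmooth) (hY : Y.IsSmooth) (hΩ : Ω.IsSmooth) (x : M) :
    (multiCourant hr hs X (interiorProduct X Ω : DiffForm m M (s + q))
        Y (interiorProduct Y Ω : DiffForm m M (r + q)) x).2
      = interior (schouten hr hs X Y x) (Ω x)
        + (-1 : ℝ) ^ ((r - 1) * s) • interior (Y x)
          (interior (X x) (Ω.d x) : TangentSpace (𝓡 m) x [⋀^Fin (s + q + 1)]→L[ℝ] ℝ) := by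
  have hYX : (interiorProduct Y (interiorProduct X Ω : DiffForm m M (s + q)) : DiffForm m M q)
      = (-1 : ℝ) ^ (r * s) •
        interiorProduct X (interiorProduct Y Ω : DiffForm m M (r + q)) := by
    funext z
    exact interior_interior (X z) (Y z) (Ω z) (by omega) (by omega)
  -- The two terms of the symmetric part of the bracket coincide on the graph.
  have hsum : (interiorProduct X (interiorProduct Y Ω : DiffForm m M (r + q)) : DiffForm m M q)
      + (-1 : ℝ) ^ (r * s) • (-1 : ℝ) ^ (r * s) •
        interiorProduct X (interiorProduct Y Ω : DiffForm m M (r + q))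
      = (2 : ℝ) • interiorProduct X (interiorProduct Y Ω : DiffForm m M (r + q)) := by
    rw [smul_smul, ← mul_pow]
    norm_num
    rw [two_smul]
  have hflat := congrArg (fun α => α.compContinuousLinearMap (toChart m x x))
    (interior_flatSchouten hr hs h (hX.differentiableAt x) (hY.differentiableAt x)
      (hΩ.differentiableAt x))
  have hΩd : Ω.d x = (extDeriv (Ω.inChart x) (extChartAt (𝓡 m) x x)).compContinuousLinearMap
      (toChart m x x) := rfl
  change interior (X x) ((interiorProduct Y Ω : DiffForm m M (r + q)).d x)
      - (-1 : ℝ) ^ r • (interiorProduct X (interiorProduct Y Ω : DiffForm m M (r + q)) :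
        DiffForm m M q).d x
      - (-1 : ℝ) ^ ((r - 1) * (s - 1)) •
        (interior (Y x) ((interiorProduct X Ω : DiffForm m M (s + q)).d x)
          - (-1 : ℝ) ^ s • (interiorProduct Y (interiorProduct X Ω : DiffForm m M (s + q)) :
            DiffForm m M q).d x)
      + ((-1 : ℝ) ^ r / 2) •
        ((interiorProduct X (interiorProduct Y Ω : DiffForm m M (r + q)) : DiffForm m M q)
          + (-1 : ℝ) ^ (r * s) •
            (interiorProduct Y (interiorProduct X Ω : DiffForm m M (s + q)))).d x = _
  rw [hYX, hsum, DiffForm.d_smul, DiffForm.d_smul, Pi.smul_apply, Pi.smul_apply, hΩd,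
    d_interiorProduct_interiorProduct_apply, d_interiorProduct_apply, d_interiorProduct_apply,
    interior_compContinuousLinearMap_toChart, interior_compContinuousLinearMap_toChart,
    interior_compContinuousLinearMap_toChart, interior_compContinuousLinearMap_toChart,
    interior_schouten]
  ext v
  have hv := congrArg (fun α => α v) hflat
  simp only [ContinuousAlternatingMap.compContinuousLinearMap_apply,
    ContinuousAlternatingMap.add_apply, ContinuousAlternatingMap.sub_apply,
    ContinuousAlternatingMap.smul_apply, smul_eq_mul] at hv ⊢
  have hsign : (-1 : ℝ) ^ ((r - 1) * (s - 1)) * (-1) ^ s * (-1) ^ (r * s) = -(-1) ^ r := by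
    obtain ⟨a, rfl⟩ : ∃ t, r = t + 1 := ⟨r - 1, by omega⟩
    obtain ⟨b, rfl⟩ : ∃ t, s = t + 1 := ⟨s - 1, by omega⟩
    have e : (a + 1 - 1) * (b + 1 - 1) + (b + 1) + (a + 1) * (b + 1)
        = a + 2 * (a * b + b + 1) := by
      rw [add_tsub_cancel_right, add_tsub_cancel_right]; ring
    rw [← pow_add, ← pow_add, e, pow_add, pow_mul]
    norm_num [pow_succ]
  rw [← hv]
  linear_combination extDeriv (fun z => (interior (X.inChart x z)
    (interior (Y.inChart x z) (Ω.inChart x z) : E [⋀^Fin (r + q)]→L[ℝ] ℝ) : E [⋀^Fin q]→L[ℝ] ℝ))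
    (extChartAt (𝓡 m) x x) (toChart m x x ∘ v) * hsign

/-- A bracket of sections of the graph of `Ω` lies in the graph if and only if `i_Y i_X dΩ = 0`. -/
theorem multiCourant_mem_graphFibre_iff {r s q k : ℕ} (hr : 1 ≤ r) (hs : 1 ≤ s)
    (h : r + s + q = k)
    {X : MultivectorField m M r} {Y : MultivectorField m M s} {Ω : DiffForm m M k}
    (hX : X.IsSmooth) (hY : Y.IsSmooth) (hΩ : Ω.IsSmooth) (x : M) :
    multiCourant hr hs X (interiorProduct X Ω : DiffForm m M (s + q))
        Y (interiorProduct Y Ω : DiffForm m M (r + q)) x ∈ graphFibre Ω (r + s - 1) (q + 1) x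
      ↔ (interior (Y x) (interior (X x) (Ω.d x) : TangentSpace (𝓡 m) x [⋀^Fin (s + q + 1)]→L[ℝ] ℝ) :
          TangentSpace (𝓡 m) x [⋀^Fin (q + 1)]→L[ℝ] ℝ) = 0 := by
  rw [mem_graphFibre, multiCourant_graph_snd hr hs h hX hY hΩ]
  change interior (schouten hr hs X Y x) (Ω x) = _ ↔ _
  rw [left_eq_add, smul_eq_zero, or_iff_right (pow_ne_zero _ (by norm_num))]

/-! ### Extension of vectors to smooth vector fields -/

/-- The coordinate expression in the chart around `x₀` of a vector with constant coefficients in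
the chart around `x`. -/
theorem toChart_fromChart_apply {x x₀ z : M} (hz : z ∈ (extChartAt (𝓡 m) x).source)
    (hz₀ : z ∈ (extChartAt (𝓡 m) x₀).source) (u : E) :
    toChart m x₀ z (fromChart m x z u)
      = fderiv ℝ (extChartAt (𝓡 m) x₀ ∘ (extChartAt (𝓡 m) x).symm) (extChartAt (𝓡 m) x z) u := by
  have h1 : (extChartAt (𝓡 m) x₀ : M → E) =ᶠ[𝓝 z]
      (extChartAt (𝓡 m) x₀ ∘ (extChartAt (𝓡 m) x).symm) ∘ extChartAt (𝓡 m) x := by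
    filter_upwards [(isOpen_extChartAt_source x).mem_nhds hz] with y hy
    rw [Function.comp_apply, Function.comp_apply, (extChartAt (𝓡 m) x).left_inv hy]
  have h3 : DifferentiableAt ℝ (extChartAt (𝓡 m) x₀ ∘ (extChartAt (𝓡 m) x).symm)
      (extChartAt (𝓡 m) x z) :=
    ((contDiffOn_ext_coord_change (n := ∞) x₀ x).contDiffAt
      ((isOpen_coordChange_source x x₀).mem_nhds
        (mem_coordChange_source hz hz₀))).differentiableAt (by simp)
  have h4 : MDifferentiableAt (𝓡 m) (𝓡 m) (extChartAt (𝓡 m) x) z :=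
    (contMDiffAt_extChartAt' (n := ∞) (by simpa using hz)).mdifferentiableAt (by simp)
  have h5 : toChart m x₀ z = (fderiv ℝ (extChartAt (𝓡 m) x₀ ∘ (extChartAt (𝓡 m) x).symm)
      (extChartAt (𝓡 m) x z)) ∘L toChart m x z := by
    rw [toChart, h1.mfderiv_eq, mfderiv_comp z h3.mdifferentiableAt h4, mfderiv_eq_fderiv]
    rfl
  rw [h5]
  exact congrArg _ (LinearMap.congr_fun (toChart_fromChart hz) u)

/-- Every vector at `x` extends to a smooth vector field on `M`: take constant coefficients in the
chart around `x` and multiply by a bump function. -/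
theorem exists_isSmooth_eq_of_one [T2Space M] (x : M) (w : ⋀[ℝ]^1 (TangentSpace (𝓡 m) x)) :
    ∃ X : MultivectorField m M 1, X.IsSmooth ∧ X x = w := by
  let f : SmoothBumpFunction (𝓡 m) x := Classical.arbitrary _
  let u : ⋀[ℝ]^1 E := exteriorPower.map 1 (toChart m x x).toLinearMap w
  refine ⟨fun z => f z • exteriorPower.map 1 (fromChart m x z).toLinearMap u, fun x₀ => ?_, ?_⟩
  · have hsymm : ContMDiffOn 𝓘(ℝ, E) (𝓡 m) ∞ (extChartAt (𝓡 m) x₀).symm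
        (extChartAt (𝓡 m) x₀).target := contMDiffOn_extChartAt_symm x₀
    intro y hy
    -- On the closed support of the bump function both charts are defined, and off it the field vanishes.
    set z := (extChartAt (𝓡 m) x₀).symm y
    have hsymm_y : ContMDiffAt 𝓘(ℝ, E) (𝓡 m) ∞ (extChartAt (𝓡 m) x₀).symm y :=
      hsymm.contMDiffAt (extChartAt_target_mem_nhds' hy)
    have htend : Filter.Tendsto (extChartAt (𝓡 m) x₀).symm (𝓝 y) (𝓝 z) :=
      hsymm_y.continuousAt
    refine ContDiffAt.contDiffWithinAt ?_
    by_cases hz : z ∈ tsupport f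
    · have hzs : z ∈ (extChartAt (𝓡 m) x).source := f.tsupport_subset_extChartAt_source hz
      have hz₀ : z ∈ (extChartAt (𝓡 m) x₀).source := (extChartAt (𝓡 m) x₀).map_target hy
      let L : E →L[ℝ] ⋀[ℝ]^1 E :=
        LinearMap.toContinuousLinearMap (exteriorPower.oneEquiv ℝ E).symm.toLinearMap
      have hf : ContDiffAt ℝ ∞ (fun y' => f ((extChartAt (𝓡 m) x₀).symm y')) y :=
        (f.contMDiffAt.comp y hsymm_y).contDiffAt
      have hφ : ContDiffAt ℝ ∞
          (fun y' => extChartAt (𝓡 m) x ((extChartAt (𝓡 m) x₀).symm y')) y :=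
        ((contMDiffAt_extChartAt' (by rwa [extChartAt_source] at hzs)).comp y hsymm_y).contDiffAt
      have hD : ContDiffAt ℝ ∞
          (fderiv ℝ (extChartAt (𝓡 m) x₀ ∘ (extChartAt (𝓡 m) x).symm)) (extChartAt (𝓡 m) x z) := by
        refine ((contDiffOn_ext_coord_change (n := ∞) x₀ x).contDiffAt
          ((isOpen_coordChange_source x x₀).mem_nhds ?_)).fderiv_right (by simp)
        exact mem_coordChange_source hzs hz₀
      have hmain : ContDiffAt ℝ ∞ (fun y' => f ((extChartAt (𝓡 m) x₀).symm y') •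
          L (fderiv ℝ (extChartAt (𝓡 m) x₀ ∘ (extChartAt (𝓡 m) x).symm)
            (extChartAt (𝓡 m) x ((extChartAt (𝓡 m) x₀).symm y'))
            (exteriorPower.oneEquiv ℝ E u))) y :=
        hf.smul (L.contDiff.contDiffAt.comp y ((hD.comp y hφ).clm_apply contDiffAt_const))
      refine hmain.congr_of_eventuallyEq ?_
      filter_upwards [htend ((isOpen_extChartAt_source x).mem_nhds hzs),
        extChartAt_target_mem_nhds' hy] with y' hy' hy'₀
      have hnat : ∀ (T : E →ₗ[ℝ] E) (c : ⋀[ℝ]^1 E),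
          exteriorPower.map 1 T c
            = (exteriorPower.oneEquiv ℝ E).symm (T (exteriorPower.oneEquiv ℝ E c)) := by
        intro T c
        rw [LinearEquiv.eq_symm_apply]
        exact LinearMap.congr_fun (exteriorPower.oneEquiv_naturality T) c
      have := toChart_fromChart_apply hy' ((extChartAt (𝓡 m) x₀).map_target hy'₀)
        (exteriorPower.oneEquiv ℝ E u)
      rw [MultivectorField.inChart, map_smul, ← LinearMap.comp_apply (exteriorPower.map 1 _),
        ← exteriorPower.map_comp, hnat, ← this]
      rfl
    · refine (contDiffAt_const (c := 0)).congr_of_eventuallyEq ?_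
      filter_upwards [htend ((isClosed_tsupport f).isOpen_compl.mem_nhds hz)] with y' hy'
      rw [MultivectorField.inChart, image_eq_zero_of_notMem_tsupport hy', zero_smul, map_zero]
  · change f x • exteriorPower.map 1 (fromChart m x x).toLinearMap u = w
    rw [f.eq_one, one_smul, ← LinearMap.comp_apply, ← exteriorPower.map_comp,
      fromChart_toChart (mem_extChartAt_source x), exteriorPower.map_id, LinearMap.id_apply]

end Manifold
end MultiDirac

/-! ### Integrability of the graph -/

open MultiDirac in
theorem mainTheorem3 (m n : ℕ) {M : Type*} [TopologicalSpace M] [T2Space M]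
    [ChartedSpace (EuclideanSpace ℝ (Fin m)) M] [IsManifold (𝓡 m) ∞ M]
    (Ω : MultiDirac.DiffForm m M (n + 2)) (hΩ : Ω.IsSmooth) :
    ((MultiDirac.graphMultiDirac Ω hΩ).IsIntegrableUpTo (n + 2) ↔ ∀ x : M, Ω.d x = 0) ∧
    (1 ≤ n →
      ((MultiDirac.graphMultiDirac Ω hΩ).IsIntegrableUpTo (n + 1) ↔ ∀ x : M, Ω.d x = 0)) := by
  -- Vector fields, `r = s = 1`, already detect `dΩ`, so any bound `N ≥ 2` gives the same condition.
  have key : ∀ N, 2 ≤ N →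
      ((graphMultiDirac Ω hΩ).IsIntegrableUpTo N ↔ ∀ x : M, Ω.d x = 0) := by
    intro N hN
    constructor
    · intro hint x
      refine eq_zero_of_interior_eq_zero (s := 1) (q := 1 + n + 1) (by omega) _ fun A => ?_
      refine eq_zero_of_interior_eq_zero (s := 1) (q := n + 1) (by omega) _ fun B => ?_
      obtain ⟨X, hX, rfl⟩ := exists_isSmooth_eq_of_one x A
      obtain ⟨Y, hY, rfl⟩ := exists_isSmooth_eq_of_one x B
      have := hint 1 1 n le_rfl le_rfl (by omega) hN X (interiorProduct X Ω) Y
        (interiorProduct Y Ω) hX (isSmooth_interiorProduct hX hΩ) hY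
        (isSmooth_interiorProduct hY hΩ) (fun _ => rfl) (fun _ => rfl) x
      exact (multiCourant_mem_graphFibre_iff le_rfl le_rfl (by omega) hX hY hΩ x).1 this
    · intro hd r s q hr hs h _ X S Y T hX _ hY _ hS hT x
      obtain rfl : interiorProduct X Ω = S := funext hS
      obtain rfl : interiorProduct Y Ω = T := funext hT
      refine (multiCourant_mem_graphFibre_iff hr hs h hX hY hΩ x).2 ?_
      rw [hd, interior_zero_right, interior_zero_right]
  exact ⟨key _ (by omega), fun _ => key _ (by omega)⟩
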